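/- Let $G$ be a compact connected (smooth, real) Lie group with Lie algebra $\mathfrak g$ of left-invariant vector fields (identified with $T_eG$), Killing form $B(X,Y)=\operatorname{tr}(\operatorname{ad}(X)\operatorname{ad}(Y))$, exponential map $X\mapsto \mathbf e^{X}$ and adjoint representation $\operatorname{Ad}$, and put $V:G\to\mathbb R$, $V(x)=\operatorname{tr}\operatorname{Ad}(x)$. Suppose that $G$ is semisimple, i.e. that the radical of $\mathfrak g$ is zero. Let $x\in Z(G)$ be a central element. Then the following hold. 1. $x$ is a non-degenerate critical point of $V$: $V$ is smooth near $x$, $\mathrm dV_x=0$, and the Hessian of $V$ at $x$ in a chart around $x$ is a non-degenerate bilinear form. 2. For every basis $Y_1,\dots,Y_n$ of $\mathfrak g$, the map $\varphi:\mathbb R^n\to G$, $\varphi(s_1,\dots,s_n)=x\cdot\mathbf e^{s_1Y_1}\cdots\mathbf e^{s_nY_n}$ (coordinates of the second kind), satisfies $\varphi(0)=x$, is a smooth local diffeomorphism at $0$ with $\mathrm d\varphi_0(\partial/\partial s_j)=Y_j(x)$ for all $j$, and $$\left.\frac{\partial^2 (V\circ\varphi)}{\partial s_j\,\partial s_k}\right|_{s=0}=B(Y_j,Y_k)\qquad\text{for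 all } j,k.$$ (In particular, the Hessian matrix is $-\mathrm{Id}$ if the basis is orthonormal with respect to $-B$.) 3. Let $X_1,\dots,X_m\in\mathfrak g$, and let $(\mathbf x_r,u_1^r,\dots,u_m^r)$ be a $T$-periodic ($T>0$) smooth trajectory of the system $\mathbf x'=\sum_{k} u_kX_k(\mathbf x)$; that is, the $u^r_k:\mathbb R\to\mathbb R$ are $C^\infty$ and $T$-periodic, and $\mathbf x_r:\mathbb R\to G$ is $T$-periodic with $\mathbf x_r'(t)=\sum_k u^r_k(t)X_k(\mathbf x_r(t))$. Suppose the trajectory is regular, i.e. the vectors $\operatorname{Ad}(\mathbf x_r(t))X_k$ ($t\in\mathbb R$, $1\le k\le m$) span $\mathfrak g$. Put $W(t,w)=\sum_{k} a_k(t,w)\,\bigl(\operatorname{Ad}(\mathbf x_r(t))X_k\bigr)(w)$, where $a_k(t,w)=\mathrm dV\bigl((\operatorname{Ad}(\mathbf x_r(t))X_k)(w)\bigr)$, and $\mathcal C_W=\{w\in G: W(t,w)=0\ \ \forall t\in\mathbb R\}$. Then $x$ is an isolated point of $\mathcal C_W$: $x\in\mathcal C_W$, and $U\cap\mathcal C_W=\{x\}$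 for some open $U\subset G$. -/

import Mathlib

open scoped Manifold ContDiff Topology

noncomputable section

namespace LieTracking

/-- A smooth real Lie group has the regularity needed for its Lie algebra `GroupLieAlgebra I G`. -/
instance instLEInftyMinSmoothnessReal : ENat.LEInfty (minSmoothness ℝ 3) := by
  rw [minSmoothness_of_isRCLikeNormedField]
  infer_instance

section Defs

variable {E : Type*} [NormedAddCommGroup E] [NormedSpace ℝ E]
  {H : Type*} [TopologicalSpace H] (I : ModelWithCorners ℝ E H)
  {G : Type*} [TopologicalSpace G] [ChartedSpace H G] [Group G]

/-- The adjoint map `Ad(x) = d(I_x)_e : T_e G → T_e G`, where `I_x y = x y x⁻¹`.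
(The target `T_{x e x⁻¹} G` of the differential is `T_e G`, because `x e x⁻¹ = e`.) -/
def Ad (x : G) : GroupLieAlgebra I G →L[ℝ] GroupLieAlgebra I G :=
  mfderiv I I (fun y : G => x * y * x⁻¹) 1

/-- The Lyapunov-like function `V = tr ∘ Ad`. -/
def V (x : G) : ℝ :=
  LinearMap.trace ℝ (GroupLieAlgebra I G) (Ad I x).toLinearMap

/-- `(x, u₁, …, u_m)` is a smooth trajectory of the left-invariant driftless system
`x' = ∑ k, u_k X_k(x)`. -/
structure IsTrajectory {m : ℕ} (X : Fin m → GroupLieAlgebra I G)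
    (x : ℝ → G) (u : Fin m → ℝ → ℝ) : Prop where
  smooth_control : ∀ k, ContDiff ℝ ∞ (u k)
  integral_curve : ∀ t : ℝ, HasMFDerivAt 𝓘(ℝ, ℝ) I x t
    ((1 : ℝ →L[ℝ] ℝ).smulRight (∑ k, u k t • mulInvariantVectorField (X k) (x t)))

/-- `(x, u₁, …, u_m)` is a `T`-periodic trajectory, `T > 0`. -/
structure IsPeriodicTrajectory {m : ℕ} (X : Fin m → GroupLieAlgebra I G)
    (x : ℝ → G) (u : Fin m → ℝ → ℝ) (T : ℝ) : Prop extends IsTrajectory I X x u where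
  period_pos : 0 < T
  periodic_state : Function.Periodic x T
  periodic_control : ∀ k, Function.Periodic (u k) T

/-- Regularity: the vectors `Ad(x(t)) X_k`, `t ∈ ℝ`, `1 ≤ k ≤ m`, span the Lie algebra. -/
def IsRegular {m : ℕ} (X : Fin m → GroupLieAlgebra I G) (x : ℝ → G) : Prop :=
  Submodule.span ℝ (Set.range fun p : ℝ × Fin m => Ad I (x p.1) (X p.2)) = ⊤

/-- `a_k(t, w) = dV (Ad(x_r(t)) X_k (w))`. Here `Ad(x_r(t)) X_k` is an element of the Lie algebra
and is evaluated at `w` as a left-invariant vector field. -/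
def feedback {m : ℕ} (X : Fin m → GroupLieAlgebra I G) (xr : ℝ → G)
    (k : Fin m) (t : ℝ) (w : G) : ℝ :=
  mfderiv I 𝓘(ℝ, ℝ) (V I) w (mulInvariantVectorField (Ad I (xr t) (X k)) w)

/-- The auxiliary time-dependent vector field
`W(t, w) = ∑ k, a_k(t, w) Ad(x_r(t)) X_k (w)`. -/
def auxField {m : ℕ} (X : Fin m → GroupLieAlgebra I G) (xr : ℝ → G)
    (t : ℝ) (w : G) : TangentSpace I w :=
  ∑ k, feedback I X xr k t w • mulInvariantVectorField (Ad I (xr t) (X k)) w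

/-- `C_W`, the set of all `w` such that `W(t, w) = 0` for all `t`. -/
def criticalSet {m : ℕ} (X : Fin m → GroupLieAlgebra I G) (xr : ℝ → G) : Set G :=
  {w | ∀ t : ℝ, auxField I X xr t w = 0}

end Defs

/-- The Hessian of a real function on a normed space, as a bilinear form. -/
def hessian {F : Type*} [NormedAddCommGroup F] [NormedSpace ℝ F] (f : F → ℝ) (p : F) :
    F →L[ℝ] F →L[ℝ] ℝ :=
  fderiv ℝ (fderiv ℝ f) p

/-- `x` is a non-degenerate critical point of the function `f` on a manifold without boundary:
`f` is smooth near `x`, `df_x = 0`, and the Hessian of `f` at `x` in a chart around `x` is a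
non-degenerate bilinear form (at a critical point this does not depend on the chart). -/
structure IsNondegenerateCriticalPoint {E : Type*} [NormedAddCommGroup E] [NormedSpace ℝ E]
    {H : Type*} [TopologicalSpace H] (I : ModelWithCorners ℝ E H)
    {M : Type*} [TopologicalSpace M] [ChartedSpace H M] (f : M → ℝ) (x : M) : Prop where
  smooth : ∀ᶠ y in 𝓝 x, ContMDiffAt I 𝓘(ℝ, ℝ) ∞ f y
  critical : mfderiv I 𝓘(ℝ, ℝ) f x = 0
  nondegenerate : ∀ v : E,
    (∀ w : E, hessian (f ∘ (extChartAt I x).symm) (extChartAt I x x) v w = 0) → v = 0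

/-- `x` is an isolated point of `S`. -/
def IsIsolatedPoint {M : Type*} [TopologicalSpace M] (S : Set M) (x : M) : Prop :=
  x ∈ S ∧ ∃ U : Set M, IsOpen U ∧ U ∩ S = {x}

section Exp

variable {E : Type*} [NormedAddCommGroup E] [NormedSpace ℝ E]
  {H : Type*} [TopologicalSpace H] (I : ModelWithCorners ℝ E H)
  {G : Type*} [TopologicalSpace G] [ChartedSpace H G] [Group G]
  [CompleteSpace E] [LieGroup I ∞ G] [T2Space G] [BoundarylessManifold I G]

/-- The left-invariant vector field of `X` has a global integral curve through the identity. -/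
theorem exists_oneParameter (X : GroupLieAlgebra I G) :
    ∃ γ : ℝ → G, γ 0 = 1 ∧ IsMIntegralCurve γ (mulInvariantVectorField (I := I) X) := by
  have hv : ContMDiff I I.tangent 1
      (fun g : G => (⟨g, mulInvariantVectorField (I := I) X g⟩ : TangentBundle I G)) :=
    (contMDiff_mulInvariantVectorField X).of_le
      (by rw [minSmoothness_of_isRCLikeNormedField]; norm_num)
  obtain ⟨γ, h0, hγ⟩ :=
    exists_isMIntegralCurveAt_of_contMDiffAt_boundaryless (t₀ := 0) (hv.contMDiffAt (x := (1 : G)))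
  obtain ⟨ε, hε, hγ⟩ := isMIntegralCurveAt_iff'.1 hγ
  refine exists_isMIntegralCurve_of_isMIntegralCurveOn hv hε (fun g => ?_) 1
  refine ⟨fun t => g * γ t, by simp [h0], fun t ht => ?_⟩
  have hL : HasMFDerivAt I I (fun y : G => g * y) (γ t)
      (mfderiv I I (fun y : G => g * y) (γ t)) :=
    ((contMDiff_mul_left (I := I) (n := ∞) (a := g)).mdifferentiableAt
      (by simp)).hasMFDerivAt
  have ht' : t ∈ Metric.ball (0 : ℝ) ε := by simpa [Real.ball_eq_Ioo] using ht
  have hγt : HasMFDerivAt 𝓘(ℝ, ℝ) I γ t _ :=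
    (hγ t ht').hasMFDerivAt (Metric.isOpen_ball.mem_nhds ht')
  have hL1 : MDifferentiableAt I I (fun y : G => γ t * y) 1 :=
    (contMDiff_mul_left (I := I) (n := ∞) (a := γ t)).mdifferentiableAt (by simp)
  have key : mfderiv I I (fun y : G => g * y) (γ t) (mulInvariantVectorField (I := I) X (γ t))
      = mulInvariantVectorField (I := I) X (g * γ t) := by
    have h := mfderiv_comp_apply_of_eq (I := I) (I' := I) (I'' := I) (x := (1 : G)) (y := γ t)
      hL.mdifferentiableAt hL1 (mul_one _) X
    have hc : (fun y : G => g * y) ∘ (fun y : G => γ t * y) = fun y : G => g * γ t * y := by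
      funext y; simp [mul_assoc]
    rw [hc] at h
    exact h.symm
  have h := (hL.comp t hγt).hasMFDerivWithinAt (s := Set.Ioo (-ε) ε)
  have hlin : (mfderiv I I (fun y : G => g * y) (γ t)).comp
      ((1 : ℝ →L[ℝ] ℝ).smulRight (mulInvariantVectorField (I := I) X (γ t))) =
      (1 : ℝ →L[ℝ] ℝ).smulRight (mulInvariantVectorField (I := I) X (g * γ t)) := by
    rw [← key]
    ext
    simp
  exact hlin ▸ h

/-- The exponential map of the Lie group: `exp X = γ(1)`, where `γ` is the integral curve of the
left-invariant vector field of `X` with `γ(0) = e`. -/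
def lieExp (X : GroupLieAlgebra I G) : G :=
  (exists_oneParameter I X).choose 1

/-- Coordinates of the second kind at `x`:
`φ(s₁, …, s_n) = x · exp(s₁ Y₁) · … · exp(s_n Y_n)`. -/
def secondKind {n : ℕ} (Y : Fin n → GroupLieAlgebra I G) (x : G) (s : Fin n → ℝ) : G :=
  x * (List.ofFn fun j => lieExp I (s j • Y j)).prod

end Exp

end LieTracking

end

/-!
If `Ad x = id`, then `V (x g) = tr (Ad g)` for all `g`. In coordinates of the second kind at `x`
the first derivatives of `V` at `0` are therefore the traces `tr (ad Y_j)`, and the mixed second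
derivatives are `tr (ad Y_j ∘ ad Y_k) = B (Y_j, Y_k)`. By Cartan's criterion `B` is non-degenerate.
Hence a linear functional that vanishes on brackets is `B (Z, ·)` for a central `Z`, which is `0`;
this applies to `tr ∘ ad`, so `x` is a critical point, and its Hessian, being `B` in suitable
coordinates, is non-degenerate.

A non-degenerate critical point is isolated among the critical points of `V`. Pairing `W (t, w) = 0`
with `dV` gives `∑ k, a_k (t, w) ^ 2 = 0`, so at a point `w` of `C_W` the differential of `V`
vanishes on all the vectors `(Ad (x_r (t)) X_k) (w)`; by regularity these span the tangent space.
-/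

noncomputable section

namespace LieTracking

section Calculus

variable {F F' A : Type*} [NormedAddCommGroup F] [NormedSpace ℝ F]
  [NormedAddCommGroup F'] [NormedSpace ℝ F'] [NormedAddCommGroup A] [NormedSpace ℝ A]

lemma contDiffOn_of_hasDerivAt_autonomous {n : ℕ∞} {f : F → F} {Ω : Set F} {c : ℝ → F} {U : Set ℝ}
    (hU : IsOpen U) (hf : ContDiffOn ℝ n f Ω) (hc : ∀ t ∈ U, HasDerivAt c (f (c t)) t)
    (hm : Set.MapsTo c U Ω) : ContDiffOn ℝ n c U := by
  refine contDiffOn_iff_forall_nat_le.2 fun k hk => ?_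
  induction k with
  | zero => exact contDiffOn_zero.2 fun t ht => (hc t ht).continuousAt.continuousWithinAt
  | succ k ih =>
    have hk' : (k : ℕ∞) ≤ n := le_trans (by norm_cast; omega) hk
    push_cast
    rw [contDiffOn_succ_iff_deriv_of_isOpen hU]
    refine ⟨fun t ht => (hc t ht).differentiableAt.differentiableWithinAt, by simp, ?_⟩
    refine ((hf.of_le (by exact_mod_cast hk')).comp (ih hk') hm).congr fun t ht => (hc t ht).deriv

lemma hasFDerivAt_fderiv {f : F → F'} {p : F} (hf : ContDiffAt ℝ 2 f p) :
    HasFDerivAt (fderiv ℝ f) (fderiv ℝ (fderiv ℝ f) p) p :=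
  ((hf.fderiv_right (m := 1) (by norm_num)).differentiableAt (by simp)).hasFDerivAt

lemma hasDerivAt_comp_add_smul {f : F → F'} {p : F} (hf : DifferentiableAt ℝ f p) (v : F) :
    HasDerivAt (fun a : ℝ => f (p + a • v)) (fderiv ℝ f p v) 0 := by
  simpa [HasLineDerivAt] using hf.hasFDerivAt.hasLineDerivAt v

lemma hessian_apply_of_eq_bilin {f : F → ℝ} {p v w : F} (hf : ContDiff ℝ 2 f)
    (β : A →L[ℝ] A →L[ℝ] ℝ) {P Q : ℝ → A} {P' Q' : A}
    (hP : HasDerivAt P P' 0) (hQ : HasDerivAt Q Q' 0)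
    (h : ∀ a b : ℝ, f (p + a • v + b • w) = β (P a) (Q b)) :
    hessian f p v w = β P' Q' := by
  have hfst (a : ℝ) : fderiv ℝ f (p + a • v) w = β.flip Q' (P a) := by
    refine (hasDerivAt_comp_add_smul (hf.differentiable (by simp) _) w).unique ?_
    simp only [h]
    exact (β (P a)).hasFDerivAt.comp_hasDerivAt (0 : ℝ) hQ
  have hsnd : HasDerivAt (fun a : ℝ => fderiv ℝ f (p + a • v) w) (hessian f p v w) 0 :=
    (hasDerivAt_comp_add_smul (hasFDerivAt_fderiv hf.contDiffAt).differentiableAt v).clm_apply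
      (hasDerivAt_const _ w) |>.congr_deriv (by simp [hessian])
  refine hsnd.unique ?_
  simp only [hfst]
  exact (β.flip Q').hasFDerivAt.comp_hasDerivAt (0 : ℝ) hP

lemma hessian_comp {f : F' → ℝ} {h : F → F'} {p : F} (hf : ContDiffAt ℝ 2 f (h p))
    (hh : ContDiffAt ℝ 2 h p) (hcrit : fderiv ℝ f (h p) = 0) (v w : F) :
    hessian (f ∘ h) p v w = hessian f (h p) (fderiv ℝ h p v) (fderiv ℝ h p w) := by
  have hd : ∀ᶠ s in 𝓝 p, fderiv ℝ (f ∘ h) s = (fderiv ℝ f (h s)).comp (fderiv ℝ h s) := by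
    filter_upwards [hh.eventually (by simp), hh.continuousAt.eventually (hf.eventually (by simp))]
      with s hhs hfs
    exact fderiv_comp s (hfs.differentiableAt (by simp)) (hhs.differentiableAt (by simp))
  have hprod := ((hasFDerivAt_fderiv hf).comp p
    (hh.differentiableAt (by simp)).hasFDerivAt).clm_comp (hasFDerivAt_fderiv hh)
  rw [hessian, (hprod.congr_of_eventuallyEq hd).fderiv]
  simp [hcrit, hessian]

lemma fderiv_fderiv_comp_inr_eq_inl {m : F × F' → A} {a : F} {b : F'}
    (hm : ContDiffAt ℝ 2 m (a, b)) (v : F) (w : F') :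
    fderiv ℝ (fun x => (fderiv ℝ m (x, b)).comp (.inr ℝ F F')) a v w =
      fderiv ℝ (fun y => (fderiv ℝ m (a, y)).comp (.inl ℝ F F')) b w v := by
  have hsymm := hm.isSymmSndFDerivAt (by simp)
  have hl := (HasFDerivAt.comp (f := fun x => (x, b)) a (hasFDerivAt_fderiv hm)
    (hasFDerivAt_prodMk_left a b)).clm_comp (hasFDerivAt_const (ContinuousLinearMap.inr ℝ F F') a)
  have hr := (HasFDerivAt.comp (f := fun y => (a, y)) b (hasFDerivAt_fderiv hm)
    (hasFDerivAt_prodMk_right a b)).clm_comp (hasFDerivAt_const (ContinuousLinearMap.inl ℝ F F') b)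
  refine (congrArg (fun T => T v w) hl.fderiv).trans
    (Eq.trans ?_ (congrArg (fun T => T w v) hr.fderiv).symm)
  simpa using hsymm.eq (v, 0) (0, w)

end Calculus

section Manifold

variable {E E' : Type*} [NormedAddCommGroup E] [NormedSpace ℝ E]
  [NormedAddCommGroup E'] [NormedSpace ℝ E']
  {M N : Type*} [TopologicalSpace M] [ChartedSpace E M] [TopologicalSpace N] [ChartedSpace E' N]
  {n : WithTop ℕ∞}

lemma isLocalDiffeomorphAt_of_eventuallyEq (Θ : OpenPartialHomeomorph M N) {f : M → N} {x : M}
    (hx : x ∈ Θ.source) (hf : ∀ᶠ y in 𝓝 x, ContMDiffAt 𝓘(ℝ, E) 𝓘(ℝ, E') n f y)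
    (hsymm : ∀ᶠ y in 𝓝 x, ContMDiffAt 𝓘(ℝ, E') 𝓘(ℝ, E) n Θ.symm (Θ y)) (hΘ : f =ᶠ[𝓝 x] Θ) :
    IsLocalDiffeomorphAt 𝓘(ℝ, E) 𝓘(ℝ, E') n f x := by
  obtain ⟨W, hW, hWo, hxW⟩ := mem_nhds_iff.1 (hf.and (hsymm.and hΘ))
  let Φ := Θ.restrOpen W hWo
  have hsource : ∀ y ∈ Φ.source, y ∈ W := fun y hy => hy.2
  refine ⟨⟨Φ.toPartialEquiv, Φ.open_source, Φ.open_target, ?_, ?_⟩, ⟨hx, hxW⟩,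
    fun y hy => (hW (hsource y hy)).2.2⟩
  · exact fun y hy => (hW (hsource y hy)).1.contMDiffWithinAt.congr
      (fun z hz => (hW (hsource z hz)).2.2.symm) (hW (hsource y hy)).2.2.symm
  · intro z hz
    have hzW := (hW (hsource _ (Φ.map_target hz))).2.1
    rw [show Θ (Φ.symm z) = z from Φ.right_inv hz] at hzW
    exact hzW.contMDiffWithinAt

lemma isLocalDiffeomorphAt_of_hasFDerivAt [CompleteSpace E] {f : E → E'} {p : E} (hn : n ≠ 0)
    (hf : ∀ᶠ q in 𝓝 p, ContDiffAt ℝ n f q) {f' : E ≃L[ℝ] E'}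
    (hf' : HasFDerivAt f (f' : E →L[ℝ] E') p) :
    IsLocalDiffeomorphAt 𝓘(ℝ, E) 𝓘(ℝ, E') n f p := by
  have hp := hf.self_of_nhds
  let Θ := hp.toOpenPartialHomeomorph f hf' hn
  have hsource : p ∈ Θ.source := hp.mem_toOpenPartialHomeomorph_source hf' hn
  have hinv : ∀ᶠ q in 𝓝 p, fderiv ℝ f q ∈ Set.range ((↑) : (E ≃L[ℝ] E') → E →L[ℝ] E') :=
    (hp.continuousAt_fderiv hn).eventually (hf'.fderiv ▸ ContinuousLinearEquiv.nhds f')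
  refine isLocalDiffeomorphAt_of_eventuallyEq Θ hsource (hf.mono fun q hq => hq.contMDiffAt) ?_
    (Filter.EventuallyEq.refl _ _)
  filter_upwards [hinv, hf, Θ.open_source.mem_nhds hsource] with q ⟨f'q, hf'q⟩ hfq hq
  have hderiv : HasFDerivAt Θ (f'q : E →L[ℝ] E') (Θ.symm (Θ q)) := by
    rw [Θ.left_inv hq, hf'q]
    exact (hfq.differentiableAt hn).hasFDerivAt
  exact (Θ.contDiffAt_symm (Θ.map_source hq) hderiv (by rwa [Θ.left_inv hq])).contMDiffAt

lemma contMDiffAt_extChartAt_symm [IsManifold 𝓘(ℝ, E) n M] (x : M) {a : E}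
    (ha : a ∈ (extChartAt 𝓘(ℝ, E) x).target) :
    ContMDiffAt 𝓘(ℝ, E) 𝓘(ℝ, E) n (extChartAt 𝓘(ℝ, E) x).symm a :=
  (contMDiffOn_extChartAt_symm x).contMDiffAt ((isOpen_extChartAt_target x).mem_nhds ha)

lemma contMDiffAt_extChartAt_of_mem [IsManifold 𝓘(ℝ, E) n M] (x : M) {y : M}
    (hy : y ∈ (extChartAt 𝓘(ℝ, E) x).source) :
    ContMDiffAt 𝓘(ℝ, E) 𝓘(ℝ, E) n (extChartAt 𝓘(ℝ, E) x) y :=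
  contMDiffAt_extChartAt' (by simpa using hy)

lemma isLocalDiffeomorphAt_extChartAt [IsManifold 𝓘(ℝ, E) n M] (x : M) :
    IsLocalDiffeomorphAt 𝓘(ℝ, E) 𝓘(ℝ, E) n (extChartAt 𝓘(ℝ, E) x) x :=
  ⟨⟨extChartAt 𝓘(ℝ, E) x, isOpen_extChartAt_source x, isOpen_extChartAt_target x,
    contMDiffOn_extChartAt.mono (by simp), contMDiffOn_extChartAt_symm x⟩,
    mem_extChartAt_source x, Set.eqOn_refl _ _⟩

lemma isLocalDiffeomorphAt_extChartAt_symm [IsManifold 𝓘(ℝ, E) n M] (x : M) {a : E}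
    (ha : a ∈ (extChartAt 𝓘(ℝ, E) x).target) :
    IsLocalDiffeomorphAt 𝓘(ℝ, E) 𝓘(ℝ, E) n (extChartAt 𝓘(ℝ, E) x).symm a :=
  ⟨⟨(extChartAt 𝓘(ℝ, E) x).symm, isOpen_extChartAt_target x, isOpen_extChartAt_source x,
    contMDiffOn_extChartAt_symm x, contMDiffOn_extChartAt.mono (by simp)⟩, ha, Set.eqOn_refl _ _⟩

lemma isLocalDiffeomorphAt_congr {f g : M → N} {x : M}
    (hf : IsLocalDiffeomorphAt 𝓘(ℝ, E) 𝓘(ℝ, E') n f x) (hfg : g =ᶠ[𝓝 x] f) :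
    IsLocalDiffeomorphAt 𝓘(ℝ, E) 𝓘(ℝ, E') n g x := by
  obtain ⟨Φ, hx, hΦ⟩ := hf
  have hgΦ : g =ᶠ[𝓝 x] Φ := hfg.trans (hΦ.eventuallyEq_of_mem (Φ.open_source.mem_nhds hx))
  have hsource : ∀ᶠ y in 𝓝 x, y ∈ Φ.source := Φ.open_source.mem_nhds hx
  refine isLocalDiffeomorphAt_of_eventuallyEq Φ.toOpenPartialHomeomorph hx ?_ ?_ hgΦ
  · filter_upwards [hgΦ.eventuallyEq_nhds, hsource] with y hy hys
    exact (Φ.contMDiffOn.contMDiffAt (Φ.open_source.mem_nhds hys)).congr_of_eventuallyEq hy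
  · filter_upwards [hsource] with y hy
    exact Φ.symm.contMDiffOn.contMDiffAt (Φ.open_target.mem_nhds (Φ.map_source hy))

variable [IsManifold 𝓘(ℝ, E) n M] [IsManifold 𝓘(ℝ, E') n N]

lemma eventually_contDiffAt_writtenInExtChartAt {f : M → N} {x : M}
    (hf : ∀ᶠ y in 𝓝 x, ContMDiffAt 𝓘(ℝ, E) 𝓘(ℝ, E') n f y) :
    ∀ᶠ a in 𝓝 (extChartAt 𝓘(ℝ, E) x x),
      ContDiffAt ℝ n (writtenInExtChartAt 𝓘(ℝ, E) 𝓘(ℝ, E') x f) a := by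
  have hsource : ∀ᶠ y in 𝓝 x, f y ∈ (extChartAt 𝓘(ℝ, E') (f x)).source :=
    hf.self_of_nhds.continuousAt.eventually (extChartAt_source_mem_nhds (f x))
  have hsymm := continuousAt_extChartAt_symm (I := 𝓘(ℝ, E)) x
  rw [ContinuousAt, extChartAt_to_inv] at hsymm
  filter_upwards [hsymm.eventually (hf.and hsource), extChartAt_target_mem_nhds x]
    with a ⟨hfa, hfs⟩ ha
  exact ((contMDiffAt_extChartAt_of_mem (f x) hfs).comp a
    (hfa.comp a (contMDiffAt_extChartAt_symm x ha))).contDiffAt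

lemma isLocalDiffeomorphAt_of_hasMFDerivAt [CompleteSpace E] {f : M → N} {x : M} (hn : n ≠ 0)
    (hf : ∀ᶠ y in 𝓝 x, ContMDiffAt 𝓘(ℝ, E) 𝓘(ℝ, E') n f y)
    {f' : E ≃L[ℝ] E'} (hf' : HasMFDerivAt 𝓘(ℝ, E) 𝓘(ℝ, E') f x (f' : E →L[ℝ] E')) :
    IsLocalDiffeomorphAt 𝓘(ℝ, E) 𝓘(ℝ, E') n f x := by
  have hderiv : HasFDerivAt (writtenInExtChartAt 𝓘(ℝ, E) 𝓘(ℝ, E') x f)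
      (f' : E →L[ℝ] E') (extChartAt 𝓘(ℝ, E) x x) := by
    have h := hf'.2
    rw [modelWithCornersSelf_coe, Set.range_id] at h
    exact hasFDerivWithinAt_univ.1 h
  have hchart := isLocalDiffeomorphAt_of_hasFDerivAt hn
    (eventually_contDiffAt_writtenInExtChartAt hf) hderiv
  have hvalue : writtenInExtChartAt 𝓘(ℝ, E) 𝓘(ℝ, E') x f (extChartAt 𝓘(ℝ, E) x x) =
      extChartAt 𝓘(ℝ, E') (f x) (f x) := by simp [writtenInExtChartAt]
  have hcomp := ((isLocalDiffeomorphAt_extChartAt x).comp _ _ hchart).comp _ _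
    (hvalue ▸ isLocalDiffeomorphAt_extChartAt_symm (f x) (mem_extChartAt_target (f x)))
  refine isLocalDiffeomorphAt_congr hcomp ?_
  filter_upwards [extChartAt_source_mem_nhds (I := 𝓘(ℝ, E)) x,
    hf.self_of_nhds.continuousAt.eventually (extChartAt_source_mem_nhds (I := 𝓘(ℝ, E')) (f x))]
    with y hy hfy
  simp only [Function.comp_apply, writtenInExtChartAt, (extChartAt 𝓘(ℝ, E) x).left_inv hy,
    (extChartAt 𝓘(ℝ, E') (f x)).left_inv hfy]

end Manifold

section CriticalPoints

variable {E F : Type*} [NormedAddCommGroup E] [NormedSpace ℝ E]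
  [NormedAddCommGroup F] [NormedSpace ℝ F]
  {M : Type*} [TopologicalSpace M] [ChartedSpace E M]

lemma fderiv_comp_eq_zero_iff {n : WithTop ℕ∞} {f : M → ℝ} {φ : F → M} {p : F} (hn : n ≠ 0)
    (hφ : IsLocalDiffeomorphAt 𝓘(ℝ, F) 𝓘(ℝ, E) n φ p)
    (hf : MDifferentiableAt 𝓘(ℝ, E) 𝓘(ℝ, ℝ) f (φ p)) :
    fderiv ℝ (f ∘ φ) p = 0 ↔ mfderiv 𝓘(ℝ, E) 𝓘(ℝ, ℝ) f (φ p) = 0 := by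
  rw [← mfderiv_eq_fderiv, mfderiv_comp p hf (hφ.mdifferentiableAt hn)]
  refine ⟨fun h => ?_, fun h => by rw [h]; exact ContinuousLinearMap.zero_comp _⟩
  ext v
  obtain ⟨u, rfl⟩ := (hφ.mfderivToContinuousLinearEquiv hn).surjective v
  exact congrArg (fun T : F →L[ℝ] ℝ => T u) h

variable [IsManifold 𝓘(ℝ, E) ∞ M]

lemma isNondegenerateCriticalPoint_of_comp {f : M → ℝ} {φ : F → M} {p : F}
    (hf : ∀ᶠ y in 𝓝 (φ p), ContMDiffAt 𝓘(ℝ, E) 𝓘(ℝ, ℝ) ∞ f y)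
    (hφ : IsLocalDiffeomorphAt 𝓘(ℝ, F) 𝓘(ℝ, E) ∞ φ p) (hcrit : fderiv ℝ (f ∘ φ) p = 0)
    (hnd : ∀ v, (∀ w, hessian (f ∘ φ) p v w = 0) → v = 0) :
    IsNondegenerateCriticalPoint 𝓘(ℝ, E) f (φ p) := by
  let c := extChartAt 𝓘(ℝ, E) (φ p)
  have hfp : MDifferentiableAt 𝓘(ℝ, E) 𝓘(ℝ, ℝ) f (φ p) :=
    hf.self_of_nhds.mdifferentiableAt (by simp)
  have hcritf := (fderiv_comp_eq_zero_iff (by simp) hφ hfp).1 hcrit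
  refine ⟨hf, hcritf, fun v hv => ?_⟩
  have hsymm : c.symm (c (φ p)) = φ p := extChartAt_to_inv (φ p)
  have hcsymm := isLocalDiffeomorphAt_extChartAt_symm (E := E) (n := ∞) (φ p)
    (mem_extChartAt_target (φ p))
  have hh : IsLocalDiffeomorphAt 𝓘(ℝ, F) 𝓘(ℝ, E) ∞ (c ∘ φ) p :=
    hφ.comp _ _ (isLocalDiffeomorphAt_extChartAt (φ p))
  have hg : ContDiffAt ℝ ∞ (f ∘ c.symm) ((c ∘ φ) p) :=
    (ContMDiffAt.comp_of_eq hf.self_of_nhds hcsymm.contMDiffAt hsymm).contDiffAt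
  have hcritg : fderiv ℝ (f ∘ c.symm) ((c ∘ φ) p) = 0 :=
    (fderiv_comp_eq_zero_iff (by simp) hcsymm (by rwa [hsymm])).2 (by rwa [hsymm])
  have hcomp : f ∘ φ =ᶠ[𝓝 p] (f ∘ c.symm) ∘ (c ∘ φ) := by
    filter_upwards [hφ.contMDiffAt.continuousAt.eventually
      (extChartAt_source_mem_nhds (I := 𝓘(ℝ, E)) (φ p))] with s hs
    simp only [Function.comp_apply, c.left_inv hs]
  let e : F ≃L[ℝ] E := hh.mfderivToContinuousLinearEquiv (by simp)
  have he : ∀ u, fderiv ℝ (c ∘ φ) p u = e u := fun u => by rw [← mfderiv_eq_fderiv]; rfl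
  have hsymmv : e.symm v = 0 := hnd _ fun w => by
    rw [hessian, hcomp.fderiv.fderiv_eq]
    refine (hessian_comp (hg.of_le ENat.LEInfty.out)
      (hh.contMDiffAt.contDiffAt.of_le ENat.LEInfty.out) hcritg _ _).trans ?_
    rw [he, e.apply_symm_apply]
    exact hv _
  simpa using hsymmv

lemma IsNondegenerateCriticalPoint.eventually_eq_of_mfderiv_eq_zero [FiniteDimensional ℝ E]
    {f : M → ℝ} {x : M} (h : IsNondegenerateCriticalPoint 𝓘(ℝ, E) f x) :
    ∀ᶠ w in 𝓝 x, mfderiv 𝓘(ℝ, E) 𝓘(ℝ, ℝ) f w = 0 → w = x := by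
  let c := extChartAt 𝓘(ℝ, E) x
  have hg : ContDiffAt ℝ 2 (f ∘ c.symm) (c x) :=
    (ContMDiffAt.comp_of_eq h.smooth.self_of_nhds
      (contMDiffAt_extChartAt_symm x (mem_extChartAt_target x))
      (extChartAt_to_inv x)).contDiffAt.of_le ENat.LEInfty.out
  have hker : (hessian (f ∘ c.symm) (c x)).toLinearMap.ker = ⊥ :=
    LinearMap.ker_eq_bot'.2 fun v hv =>
      h.nondegenerate v fun w => congrArg (fun T : E →L[ℝ] ℝ => T w) hv
  obtain ⟨K, -, hK⟩ := LinearMap.exists_antilipschitzWith _ hker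
  have hne := (hasFDerivAt_fderiv hg).eventually_ne (c := 0) ⟨K, hK⟩
  rw [eventually_nhdsWithin_iff] at hne
  filter_upwards [(continuousAt_extChartAt (I := 𝓘(ℝ, E)) x).eventually hne,
    extChartAt_source_mem_nhds (I := 𝓘(ℝ, E)) x, h.smooth] with w hw hs hfw hz
  by_contra hwx
  refine hw (fun e => hwx (c.injOn hs (mem_extChartAt_source x) e)) ?_
  have hsymm : c.symm (c w) = w := c.left_inv hs
  refine (fderiv_comp_eq_zero_iff (n := ∞) (by simp)
    (isLocalDiffeomorphAt_extChartAt_symm x (c.map_source hs)) ?_).2 ?_ <;> rw [hsymm]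
  exacts [hfw.mdifferentiableAt (by simp), hz]

end CriticalPoints

section LieAlgebra

variable {K L : Type*} [Field K] [LieRing L] [LieAlgebra K L] [FiniteDimensional K L]
  [LieAlgebra.IsKilling K L]

lemma eq_zero_of_forall_apply_lie_eq_zero (f : Module.Dual K L) (hf : ∀ X Y : L, f ⁅X, Y⁆ = 0) :
    f = 0 := by
  -- `f = B(Z, ·)`, and the invariance of `B` makes `Z` central.
  obtain ⟨Z, rfl⟩ := ((killingForm K L).toDual
    (LieAlgebra.IsKilling.killingForm_nondegenerate K L)).surjective f
  have hbracket (X : L) : ⁅X, Z⁆ = 0 := by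
    refine (LieAlgebra.IsKilling.killingForm_nondegenerate K L).1 _ fun Y => ?_
    rw [← lie_skew, map_neg, LinearMap.neg_apply, neg_eq_zero]
    exact (LieModule.traceForm_apply_lie_apply K L L Z X Y).trans (hf X Y)
  have hcenter : Z ∈ LieAlgebra.center K L := (LieModule.mem_maxTrivSubmodule K L L Z).2 hbracket
  rw [LieAlgebra.center_eq_bot, LieSubmodule.mem_bot] at hcenter
  rw [hcenter, map_zero]

lemma trace_ad_eq_zero (X : L) : LinearMap.trace K L (LieAlgebra.ad K L X) = 0 :=
  LinearMap.congr_fun (eq_zero_of_forall_apply_lie_eq_zero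
    (LinearMap.trace K L ∘ₗ (LieAlgebra.ad K L : L →ₗ[K] Module.End K L)) fun Y Z => by simp) X

end LieAlgebra

section AdjointRepresentation

variable {E : Type*} [NormedAddCommGroup E] [NormedSpace ℝ E]
  {G : Type*} [TopologicalSpace G] [ChartedSpace E G] [Group G]

variable (E) in
/-- The adjoint representation as a map into the normed space `E →L[ℝ] E`: the model space `E`
carries a norm, whereas the tangent space `T_e G`, which is the same type, does not. -/
def modelAd (x : G) : E →L[ℝ] E := Ad 𝓘(ℝ, E) x

lemma Ad_eq_id_of_mem_center {x : G} (hx : x ∈ Subgroup.center G) :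
    Ad 𝓘(ℝ, E) x = ContinuousLinearMap.id ℝ (GroupLieAlgebra 𝓘(ℝ, E) G) := by
  have hconj : (fun y : G => x * y * x⁻¹) = id := by
    funext y
    simp [← Subgroup.mem_center_iff.1 hx y]
  rw [Ad, hconj]
  exact mfderiv_id

lemma modelAd_one : modelAd E (1 : G) = ContinuousLinearMap.id ℝ E :=
  Ad_eq_id_of_mem_center (Subgroup.one_mem _)

variable [LieGroup 𝓘(ℝ, E) ∞ G]

lemma mdifferentiableAt_conj (x y : G) :
    MDifferentiableAt 𝓘(ℝ, E) 𝓘(ℝ, E) (fun z : G => x * z * x⁻¹) y :=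
  ((contMDiff_const.mul contMDiff_id).mul contMDiff_const : ContMDiff 𝓘(ℝ, E) 𝓘(ℝ, E) ∞
    fun z : G => x * z * x⁻¹).mdifferentiableAt (by simp)

lemma modelAd_mul (x y : G) : modelAd E (x * y) = (modelAd E x).comp (modelAd E y) := by
  ext v
  refine Eq.trans ?_ (mfderiv_comp_apply_of_eq (x := (1 : G)) (mdifferentiableAt_conj x 1)
    (mdifferentiableAt_conj (E := E) y 1) (by group) v)
  have hconj : (fun z : G => x * y * z * (x * y)⁻¹) =
      (fun z => x * z * x⁻¹) ∘ fun z => y * z * y⁻¹ := by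
    funext z
    simp only [Function.comp_apply]
    group
  rw [modelAd, Ad, hconj]
  rfl

lemma contMDiff_modelAd : ContMDiff 𝓘(ℝ, E) 𝓘(ℝ, E →L[ℝ] E) ∞ (modelAd E : G → E →L[ℝ] E) := by
  intro x₀
  have hconj : ContMDiffAt (𝓘(ℝ, E).prod 𝓘(ℝ, E)) 𝓘(ℝ, E) ∞
      (Function.uncurry fun x y : G => x * y * x⁻¹) (x₀, 1) :=
    (contMDiffAt_fst.mul contMDiffAt_snd).mul contMDiffAt_fst.inv
  have hcoord : ContMDiffAt 𝓘(ℝ, E) 𝓘(ℝ, E →L[ℝ] E) ∞ (inTangentCoordinates 𝓘(ℝ, E) 𝓘(ℝ, E)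
      (fun _ : G => (1 : G)) (fun x : G => x * 1 * x⁻¹) (fun x => modelAd E x) x₀) x₀ :=
    ContMDiffAt.mfderiv (fun x y : G => x * y * x⁻¹) (fun _ => 1) hconj
      (contMDiffAt_const (n := ∞)) (by simp)
  refine hcoord.congr_of_eventuallyEq (Filter.Eventually.of_forall fun x => ?_)
  have hone : ∀ x : G, x * 1 * x⁻¹ = 1 := by simp
  rw [inTangentCoordinates_eq _ _ _ (by simp) (by simp)]
  ext v
  simp only [hone]
  rw [ContinuousLinearMap.comp_apply, ContinuousLinearMap.comp_apply,
    (tangentBundleCore 𝓘(ℝ, E) G).coordChange_self _ _ (mem_chart_source E (1 : G)),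
    (tangentBundleCore 𝓘(ℝ, E) G).coordChange_self _ _ (mem_chart_source E (1 : G))]

variable (E) in
/-- The differential at the identity of the left translation by `g`; it maps `X` to the value at
`g` of the left-invariant vector field of `X`. -/
def leftTranslationEquiv (g : G) : E ≃L[ℝ] E :=
  (⟨Equiv.mulLeft g, contMDiff_mul_left, contMDiff_mul_left⟩ :
    G ≃ₘ^∞⟮𝓘(ℝ, E), 𝓘(ℝ, E)⟯ G).mfderivToContinuousLinearEquiv (by simp) 1

end AdjointRepresentation

section Trace

variable (E : Type*) [NormedAddCommGroup E] [NormedSpace ℝ E] [FiniteDimensional ℝ E]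

/-- The trace as a continuous linear functional on `E →L[ℝ] E`. -/
def traceCLM : (E →L[ℝ] E) →L[ℝ] ℝ :=
  LinearMap.toContinuousLinearMap (LinearMap.trace ℝ E ∘ₗ ContinuousLinearMap.coeLM ℝ)

variable {E}

lemma traceCLM_comp_comm (S T : E →L[ℝ] E) : traceCLM E (S.comp T) = traceCLM E (T.comp S) :=
  LinearMap.trace_mul_comm ℝ S.toLinearMap T.toLinearMap

variable {G : Type*} [TopologicalSpace G] [ChartedSpace E G] [Group G]

lemma V_eq_traceCLM (x : G) : V 𝓘(ℝ, E) x = traceCLM E (modelAd E x) := rfl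

variable [LieGroup 𝓘(ℝ, E) ∞ G]

lemma contMDiff_V : ContMDiff 𝓘(ℝ, E) 𝓘(ℝ, ℝ) ∞ (V 𝓘(ℝ, E) : G → ℝ) :=
  (traceCLM E).contDiff.contMDiff.comp contMDiff_modelAd

lemma V_mul_of_Ad_eq_id {x : G}
    (hx : Ad 𝓘(ℝ, E) x = ContinuousLinearMap.id ℝ (GroupLieAlgebra 𝓘(ℝ, E) G)) (y : G) :
    V 𝓘(ℝ, E) (x * y) = V 𝓘(ℝ, E) y := by
  rw [V_eq_traceCLM, modelAd_mul, show modelAd E x = ContinuousLinearMap.id ℝ E from hx,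
    ContinuousLinearMap.id_comp, V_eq_traceCLM]

end Trace

section BracketFormula

variable {E : Type*} [NormedAddCommGroup E] [NormedSpace ℝ E]
  {G : Type*} [TopologicalSpace G] [ChartedSpace E G] [Group G]

variable (E G) in
/-- The preferred chart at the identity. -/
abbrev oneChart : PartialEquiv G E := extChartAt 𝓘(ℝ, E) (1 : G)

variable (G) in
/-- The group multiplication read in the chart at the identity. -/
def chartMul (p : E × E) : E :=
  oneChart E G ((oneChart E G).symm p.1 * (oneChart E G).symm p.2)

variable (G) in
/-- The differential at the identity of left translation by the point with coordinates `a`, read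
in the chart at the identity. -/
def chartLeft (a : E) : E →L[ℝ] E :=
  (fderiv ℝ (chartMul G) (a, oneChart E G 1)).comp (.inr ℝ E E)

variable (G) in
/-- The differential at the identity of right translation by the point with coordinates `a`, read
in the chart at the identity. -/
def chartRight (a : E) : E →L[ℝ] E :=
  (fderiv ℝ (chartMul G) (oneChart E G 1, a)).comp (.inl ℝ E E)

variable (E G) in
/-- The differential at the identity of the adjoint representation. -/
def adDeriv : E →L[ℝ] E →L[ℝ] E :=
  fderiv ℝ (fun a : E => modelAd E ((oneChart E G).symm a)) (oneChart E G 1)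

variable [LieGroup 𝓘(ℝ, E) ∞ G]

lemma contDiffAt_chartMul {p : E × E} (h₁ : p.1 ∈ (oneChart E G).target)
    (h₂ : p.2 ∈ (oneChart E G).target)
    (h : (oneChart E G).symm p.1 * (oneChart E G).symm p.2 ∈ (oneChart E G).source) :
    ContDiffAt ℝ ∞ (chartMul G) p := by
  have hfst : ContMDiffAt 𝓘(ℝ, E × E) 𝓘(ℝ, E) ∞ (fun p : E × E => (oneChart E G).symm p.1) p :=
    (contMDiffAt_extChartAt_symm 1 h₁).comp p contDiff_fst.contMDiff.contMDiffAt
  have hsnd : ContMDiffAt 𝓘(ℝ, E × E) 𝓘(ℝ, E) ∞ (fun p : E × E => (oneChart E G).symm p.2) p :=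
    (contMDiffAt_extChartAt_symm 1 h₂).comp p contDiff_snd.contMDiff.contMDiffAt
  exact ((contMDiffAt_extChartAt_of_mem 1 h).comp p (hfst.mul hsnd)).contDiffAt

lemma contDiffAt_chartMul_left {a : E} (ha : a ∈ (oneChart E G).target) :
    ContDiffAt ℝ ∞ (chartMul G) (a, oneChart E G 1) :=
  contDiffAt_chartMul ha (mem_extChartAt_target 1)
    (by simpa only [extChartAt_to_inv, mul_one] using (oneChart E G).map_target ha)

lemma contDiffAt_chartMul_right {a : E} (ha : a ∈ (oneChart E G).target) :
    ContDiffAt ℝ ∞ (chartMul G) (oneChart E G 1, a) :=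
  contDiffAt_chartMul (mem_extChartAt_target 1) ha
    (by simpa only [extChartAt_to_inv, one_mul] using (oneChart E G).map_target ha)

lemma contDiffAt_chartLeft {a : E} (ha : a ∈ (oneChart E G).target) :
    ContDiffAt ℝ ∞ (chartLeft G) a :=
  (((contDiffAt_chartMul_left ha).fderiv_right (m := ∞) (by simp)).comp a
    (contDiffAt_id.prodMk contDiffAt_const)).clm_comp contDiffAt_const

lemma contDiffAt_chartRight {a : E} (ha : a ∈ (oneChart E G).target) :
    ContDiffAt ℝ ∞ (chartRight G) a :=
  (((contDiffAt_chartMul_right ha).fderiv_right (m := ∞) (by simp)).comp a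
    (contDiffAt_const.prodMk contDiffAt_id)).clm_comp contDiffAt_const

lemma hasFDerivAt_chartMul_left {a : E} (ha : a ∈ (oneChart E G).target) :
    HasFDerivAt (fun b => chartMul G (a, b)) (chartLeft G a) (oneChart E G 1) :=
  ((contDiffAt_chartMul_left ha).differentiableAt (by simp)).hasFDerivAt.comp
    (oneChart E G 1) (hasFDerivAt_prodMk_right a (oneChart E G 1))

lemma hasFDerivAt_chartMul_right {a : E} (ha : a ∈ (oneChart E G).target) :
    HasFDerivAt (fun b => chartMul G (b, a)) (chartRight G a) (oneChart E G 1) :=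
  HasFDerivAt.comp (f := fun b => (b, a)) (oneChart E G 1)
    ((contDiffAt_chartMul_right ha).differentiableAt (by simp)).hasFDerivAt
    (hasFDerivAt_prodMk_left (oneChart E G 1) a)

lemma chartLeft_one : chartLeft G (oneChart E G 1) = .id ℝ E := by
  refine (hasFDerivAt_chartMul_left (G := G) (mem_extChartAt_target 1)).unique
    ((hasFDerivAt_id (𝕜 := ℝ) _).congr_of_eventuallyEq ?_)
  filter_upwards [extChartAt_target_mem_nhds (I := 𝓘(ℝ, E)) (1 : G)] with b hb
  simp only [chartMul, extChartAt_to_inv, one_mul, (oneChart E G).right_inv hb, id_eq]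

lemma chartRight_one : chartRight G (oneChart E G 1) = .id ℝ E := by
  refine (hasFDerivAt_chartMul_right (G := G) (mem_extChartAt_target 1)).unique
    ((hasFDerivAt_id (𝕜 := ℝ) _).congr_of_eventuallyEq ?_)
  filter_upwards [extChartAt_target_mem_nhds (I := 𝓘(ℝ, E)) (1 : G)] with b hb
  simp only [chartMul, extChartAt_to_inv, mul_one, (oneChart E G).right_inv hb, id_eq]

lemma fderiv_chartLeft_eq_chartRight (X Y : E) :
    fderiv ℝ (chartLeft G) (oneChart E G 1) X Y =
      fderiv ℝ (chartRight G) (oneChart E G 1) Y X :=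
  fderiv_fderiv_comp_inr_eq_inl
    ((contDiffAt_chartMul_left (mem_extChartAt_target 1)).of_le ENat.LEInfty.out) X Y

lemma chartLeft_apply_eq_mfderiv {g : G} (hg : g ∈ (oneChart E G).source)
    (X : GroupLieAlgebra 𝓘(ℝ, E) G) :
    chartLeft G (oneChart E G g) X =
      mfderiv 𝓘(ℝ, E) 𝓘(ℝ, E) (oneChart E G) g (mulInvariantVectorField X g) := by
  have hchart : MDifferentiableAt 𝓘(ℝ, E) 𝓘(ℝ, E) (oneChart E G) g :=
    (contMDiffAt_extChartAt_of_mem (n := ∞) 1 hg).mdifferentiableAt (by simp)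
  have hleft : MDifferentiableAt 𝓘(ℝ, E) 𝓘(ℝ, E) (fun y : G => g * y) 1 :=
    (contMDiff_mul_left (n := ∞)).mdifferentiableAt (by simp)
  have hcomp : HasMFDerivAt 𝓘(ℝ, E) 𝓘(ℝ, E) (oneChart E G ∘ fun y : G => g * y) 1
      (chartLeft (E := E) G (oneChart E G g)) := by
    refine ⟨hchart.continuousAt.comp_of_eq hleft.continuousAt (mul_one g),
      HasFDerivAt.hasFDerivWithinAt ?_⟩
    refine (hasFDerivAt_chartMul_left ((oneChart E G).map_source hg)).congr_of_eventuallyEq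
      (Filter.Eventually.of_forall fun b => ?_)
    simp only [chartMul, (oneChart E G).left_inv hg]
    rfl
  rw [← hcomp.mfderiv]
  exact mfderiv_comp_apply_of_eq (x := (1 : G)) hchart hleft (mul_one g) X

lemma hasFDerivAt_chart_conj (x : G) :
    HasFDerivAt (fun b : E => oneChart E G (x * (oneChart E G).symm b * x⁻¹))
      (modelAd E x) (oneChart E G 1) := by
  have hone : x * 1 * x⁻¹ = 1 := by group
  have hwithin : HasFDerivWithinAt (fun b : E => extChartAt 𝓘(ℝ, E) (x * 1 * x⁻¹)
      (x * (oneChart E G).symm b * x⁻¹)) (modelAd E x) (Set.range 𝓘(ℝ, E)) (oneChart E G 1) :=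
    (mdifferentiableAt_conj (E := E) x 1).hasMFDerivAt.2
  rwa [hone, modelWithCornersSelf_coe, Set.range_id, hasFDerivWithinAt_univ] at hwithin

lemma chartLeft_eq_chartRight_comp_modelAd {a : E} (ha : a ∈ (oneChart E G).target) :
    chartLeft G a = (chartRight G a).comp (modelAd E ((oneChart E G).symm a)) := by
  set g := (oneChart E G).symm a
  have hone : g * (oneChart E G).symm (oneChart E G 1) * g⁻¹ = 1 := by
    rw [extChartAt_to_inv, mul_one, mul_inv_cancel]
  have hright := hasFDerivAt_chartMul_right ha
  rw [← congrArg (oneChart E G) hone] at hright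
  have hcomp := HasFDerivAt.comp (oneChart E G 1) hright (hasFDerivAt_chart_conj g)
  refine (hasFDerivAt_chartMul_left ha).unique (hcomp.congr_of_eventuallyEq ?_)
  have hcont : ContinuousAt (fun b : E => g * (oneChart E G).symm b * g⁻¹) (oneChart E G 1) :=
    (mdifferentiableAt_conj (E := E) g _).continuousAt.comp (continuousAt_extChartAt_symm 1)
  have hsource : (oneChart E G).source ∈ 𝓝 (g * (oneChart E G).symm (oneChart E G 1) * g⁻¹) := by
    rw [hone]
    exact extChartAt_source_mem_nhds 1
  filter_upwards [hcont.preimage_mem_nhds hsource] with b hb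
  simp only [Function.comp_apply, chartMul, (oneChart E G).left_inv hb]
  exact congrArg (oneChart E G) (inv_mul_cancel_right _ _).symm

lemma hasFDerivAt_modelAd_comp_chart_symm : HasFDerivAt
    (fun a : E => modelAd E ((oneChart E G).symm a)) (adDeriv E G) (oneChart E G 1) := by
  have hsmooth : ContMDiffAt 𝓘(ℝ, E) 𝓘(ℝ, E →L[ℝ] E) ∞
      (fun a : E => modelAd E ((oneChart E G).symm a)) (oneChart E G 1) :=
    ContMDiffAt.comp _ (contMDiff_modelAd (E := E) (G := G)).contMDiffAt
      (contMDiffAt_extChartAt_symm 1 (mem_extChartAt_target 1))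
  exact (hsmooth.contDiffAt.differentiableAt (by simp)).hasFDerivAt

/-- Differentiate `L_a = R_a ∘ Ad(a)` at `a = e`. -/
lemma adDeriv_apply (X Y : E) : adDeriv E G X Y =
    fderiv ℝ (chartLeft G) (oneChart E G 1) X Y -
      fderiv ℝ (chartLeft G) (oneChart E G 1) Y X := by
  have hleft : HasFDerivAt (chartLeft G) (fderiv ℝ (chartLeft G) (oneChart E G 1))
      (oneChart E G 1) :=
    ((contDiffAt_chartLeft (mem_extChartAt_target 1)).differentiableAt (by simp)).hasFDerivAt
  have hright : HasFDerivAt (chartRight G) (fderiv ℝ (chartRight G) (oneChart E G 1))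
      (oneChart E G 1) :=
    ((contDiffAt_chartRight (mem_extChartAt_target 1)).differentiableAt (by simp)).hasFDerivAt
  have hproduct := (hright.clm_comp (hasFDerivAt_modelAd_comp_chart_symm
    (G := G))).congr_of_eventuallyEq (f₁ := chartLeft G) (by
      filter_upwards [extChartAt_target_mem_nhds (I := 𝓘(ℝ, E)) (1 : G)] with a ha
      exact chartLeft_eq_chartRight_comp_modelAd ha)
  have hderiv := congrArg (fun T : E →L[ℝ] E →L[ℝ] E => T X Y) (hleft.unique hproduct)
  simp only [extChartAt_to_inv, modelAd_one, chartRight_one] at hderiv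
  rw [fderiv_chartLeft_eq_chartRight Y X, eq_sub_iff_add_eq, hderiv]
  simp

lemma mpullbackWithin_mulInvariantVectorField {a : E} (ha : a ∈ (oneChart E G).target)
    (X : GroupLieAlgebra 𝓘(ℝ, E) G) :
    VectorField.mpullbackWithin 𝓘(ℝ, E) 𝓘(ℝ, E) (oneChart E G).symm
      (mulInvariantVectorField X) Set.univ a = chartLeft G a X := by
  have hinv := ContinuousLinearMap.inverse_eq
    (mfderivWithin_extChartAt_symm_comp_mfderiv_extChartAt (I := 𝓘(ℝ, E)) ha)
    (mfderiv_extChartAt_comp_mfderivWithin_extChartAt_symm (I := 𝓘(ℝ, E)) ha)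
  have hleft := chartLeft_apply_eq_mfderiv ((oneChart E G).map_target ha) X
  rw [(oneChart E G).right_inv ha] at hleft
  rw [modelWithCornersSelf_coe, Set.range_id] at hinv
  rw [hleft, VectorField.mpullbackWithin, hinv]

lemma lieBracketWithin_eq_adDeriv {P Q : E → E} {X Y : E}
    (hP : P =ᶠ[𝓝 (oneChart E G 1)] fun a => chartLeft G a X)
    (hQ : Q =ᶠ[𝓝 (oneChart E G 1)] fun a => chartLeft G a Y) :
    VectorField.lieBracketWithin ℝ P Q Set.univ (oneChart E G 1) = adDeriv E G X Y := by
  have hd : ∀ Z : E, HasFDerivAt (fun a => chartLeft G a Z) _ (oneChart E G 1) := fun Z =>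
    ((contDiffAt_chartLeft (mem_extChartAt_target 1)).differentiableAt
      (by simp)).hasFDerivAt.clm_apply (hasFDerivAt_const Z _)
  rw [VectorField.lieBracketWithin, fderivWithin_univ, fderivWithin_univ, hP.fderiv_eq,
    hQ.fderiv_eq, hP.eq_of_nhds, hQ.eq_of_nhds, (hd X).fderiv, (hd Y).fderiv, adDeriv_apply,
    chartLeft_one]
  simp

lemma lie_eq_adDeriv (X Y : GroupLieAlgebra 𝓘(ℝ, E) G) : ⁅X, Y⁆ = adDeriv E G X Y := by
  let pulledBack (Z : GroupLieAlgebra 𝓘(ℝ, E) G) (a : E) : E :=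
    VectorField.mpullbackWithin 𝓘(ℝ, E) 𝓘(ℝ, E) (oneChart E G).symm
      (mulInvariantVectorField Z) Set.univ a
  have hpulledBack (Z : GroupLieAlgebra 𝓘(ℝ, E) G) :
      pulledBack Z =ᶠ[𝓝 (oneChart E G 1)] fun a => chartLeft G a Z := by
    filter_upwards [extChartAt_target_mem_nhds (I := 𝓘(ℝ, E)) (1 : G)] with a ha
    exact mpullbackWithin_mulInvariantVectorField ha Z
  have hinv : (mfderiv 𝓘(ℝ, E) 𝓘(ℝ, E) (oneChart E G) (1 : G)).inverse = .id ℝ _ := by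
    rw [mfderiv_extChartAt_self]
    exact ContinuousLinearMap.inverse_id
  refine Eq.trans ?_ (lieBracketWithin_eq_adDeriv (E := E) (hpulledBack X) (hpulledBack Y))
  rw [GroupLieAlgebra.bracket_def, ← VectorField.mlieBracketWithin_univ,
    VectorField.mlieBracketWithin_apply, hinv]
  simp only [Set.preimage_univ, Set.univ_inter, modelWithCornersSelf_coe, Set.range_id]
  rfl

instance finiteDimensional_groupLieAlgebra [FiniteDimensional ℝ E] :
    FiniteDimensional ℝ (GroupLieAlgebra 𝓘(ℝ, E) G) :=
  inferInstanceAs (FiniteDimensional ℝ E)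

variable [CompleteSpace E]

lemma ad_eq_adDeriv (X : GroupLieAlgebra 𝓘(ℝ, E) G) :
    LieAlgebra.ad ℝ (GroupLieAlgebra 𝓘(ℝ, E) G) X = (adDeriv E G X).toLinearMap :=
  LinearMap.ext fun Y => lie_eq_adDeriv X Y

variable [FiniteDimensional ℝ E]

lemma killingForm_eq_traceCLM (X Y : GroupLieAlgebra 𝓘(ℝ, E) G) :
    killingForm ℝ (GroupLieAlgebra 𝓘(ℝ, E) G) X Y =
      traceCLM E ((adDeriv E G X).comp (adDeriv E G Y)) := by
  rw [killingForm_apply_apply, ad_eq_adDeriv, ad_eq_adDeriv]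
  rfl

lemma traceCLM_adDeriv [LieAlgebra.IsKilling ℝ (GroupLieAlgebra 𝓘(ℝ, E) G)]
    (X : GroupLieAlgebra 𝓘(ℝ, E) G) : traceCLM E (adDeriv E G X) = 0 :=
  (congrArg (LinearMap.trace ℝ _) (ad_eq_adDeriv X)).symm.trans (trace_ad_eq_zero X)

end BracketFormula

section Exponential

lemma hasDerivAt_of_hasMFDerivAt {F : Type*} [NormedAddCommGroup F] [NormedSpace ℝ F]
    {c : ℝ → F} {t : ℝ} {T : ℝ →L[ℝ] F} (h : HasMFDerivAt 𝓘(ℝ, ℝ) 𝓘(ℝ, F) c t T) :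
    HasDerivAt c (T 1) t :=
  HasFDerivAt.hasDerivAt (F := F) h.hasFDerivAt

variable {E : Type*} [NormedAddCommGroup E] [NormedSpace ℝ E]
  {G : Type*} [TopologicalSpace G] [ChartedSpace E G] [Group G] [LieGroup 𝓘(ℝ, E) ∞ G]

lemma mdifferentiableAt_mul_left (g h : G) :
    MDifferentiableAt 𝓘(ℝ, E) 𝓘(ℝ, E) (fun y : G => g * y) h :=
  (contMDiff_mul_left (n := ∞)).mdifferentiableAt (by simp)

lemma mfderiv_mul_left_mulInvariantVectorField (g h : G) (X : GroupLieAlgebra 𝓘(ℝ, E) G) :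
    mfderiv 𝓘(ℝ, E) 𝓘(ℝ, E) (fun y : G => g * y) h (mulInvariantVectorField X h) =
      mulInvariantVectorField X (g * h) := by
  have hcomp := mfderiv_comp_apply_of_eq (x := (1 : G)) (mdifferentiableAt_mul_left g h)
    (mdifferentiableAt_mul_left (E := E) h 1) (mul_one h) X
  have hmul : (fun y : G => g * y) ∘ (fun y : G => h * y) = fun y : G => g * h * y :=
    funext fun y => (mul_assoc g h y).symm
  rw [hmul] at hcomp
  exact hcomp.symm

lemma isMIntegralCurve_mul_left {γ : ℝ → G} {X : GroupLieAlgebra 𝓘(ℝ, E) G}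
    (hγ : IsMIntegralCurve γ (mulInvariantVectorField (I := 𝓘(ℝ, E)) X)) (g : G) :
    IsMIntegralCurve (fun t => g * γ t) (mulInvariantVectorField (I := 𝓘(ℝ, E)) X) := by
  intro t
  refine ((mdifferentiableAt_mul_left g (γ t)).hasMFDerivAt.comp t (hγ t)).congr_mfderiv ?_
  rw [← mfderiv_mul_left_mulInvariantVectorField]
  exact ContinuousLinearMap.ext fun (c : ℝ) =>
    map_smul (mfderiv 𝓘(ℝ, E) 𝓘(ℝ, E) (fun y : G => g * y) (γ t)) c _

variable [T2Space G]

lemma isMIntegralCurve_mulInvariantVectorField_unique {γ δ : ℝ → G}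
    {X : GroupLieAlgebra 𝓘(ℝ, E) G}
    (hγ : IsMIntegralCurve γ (mulInvariantVectorField (I := 𝓘(ℝ, E)) X))
    (hδ : IsMIntegralCurve δ (mulInvariantVectorField (I := 𝓘(ℝ, E)) X)) (h : γ 0 = δ 0) :
    γ = δ :=
  isMIntegralCurve_Ioo_eq_of_contMDiff_boundaryless (t₀ := 0)
    ((contMDiff_mulInvariantVectorField X).of_le
      (by rw [minSmoothness_of_isRCLikeNormedField]; norm_num)) hγ hδ h

variable [CompleteSpace E]

lemma lieExp_smul_eq_of_isMIntegralCurve {γ : ℝ → G} {X : GroupLieAlgebra 𝓘(ℝ, E) G}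
    (hγ : IsMIntegralCurve γ (mulInvariantVectorField (I := 𝓘(ℝ, E)) X)) (h : γ 0 = 1) (s : ℝ) :
    lieExp 𝓘(ℝ, E) (s • X) = γ s := by
  obtain ⟨hone, hcurve⟩ := (exists_oneParameter 𝓘(ℝ, E) (s • X)).choose_spec
  have hscaled := hγ.comp_mul s
  rw [← mulInvariantVectorField_smul] at hscaled
  have heq := isMIntegralCurve_mulInvariantVectorField_unique hcurve hscaled (by simp [hone, h])
  simpa [lieExp] using congrFun heq 1

lemma isMIntegralCurve_lieExp_smul (X : GroupLieAlgebra 𝓘(ℝ, E) G) :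
    IsMIntegralCurve (fun s : ℝ => lieExp 𝓘(ℝ, E) (s • X) : ℝ → G)
      (mulInvariantVectorField (I := 𝓘(ℝ, E)) X) := by
  obtain ⟨γ, hone, hγ⟩ := exists_oneParameter 𝓘(ℝ, E) X
  rwa [funext (lieExp_smul_eq_of_isMIntegralCurve hγ hone)]

lemma lieExp_zero_smul (X : GroupLieAlgebra 𝓘(ℝ, E) G) :
    lieExp 𝓘(ℝ, E) ((0 : ℝ) • X) = 1 := by
  obtain ⟨γ, hone, hγ⟩ := exists_oneParameter 𝓘(ℝ, E) X
  rw [lieExp_smul_eq_of_isMIntegralCurve hγ hone, hone]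

lemma lieExp_add_smul (X : GroupLieAlgebra 𝓘(ℝ, E) G) (a b : ℝ) :
    lieExp 𝓘(ℝ, E) ((a + b) • X) = lieExp 𝓘(ℝ, E) (a • X) * lieExp 𝓘(ℝ, E) (b • X) := by
  have heq := isMIntegralCurve_mulInvariantVectorField_unique
    ((isMIntegralCurve_lieExp_smul X).comp_add a)
    (isMIntegralCurve_mul_left (isMIntegralCurve_lieExp_smul X) (lieExp 𝓘(ℝ, E) (a • X)))
    (by simp only [Function.comp_apply, zero_add, lieExp_zero_smul, mul_one])
  simpa only [Function.comp_apply, add_comm b a] using congrFun heq b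

lemma continuous_lieExp_smul (X : GroupLieAlgebra 𝓘(ℝ, E) G) :
    Continuous (fun s : ℝ => lieExp 𝓘(ℝ, E) (s • X) : ℝ → G) :=
  continuous_iff_continuousAt.2 fun t => (isMIntegralCurve_lieExp_smul X t).continuousAt

lemma isOpen_preimage_lieExp_smul (X : GroupLieAlgebra 𝓘(ℝ, E) G) :
    IsOpen ((fun s : ℝ => lieExp 𝓘(ℝ, E) (s • X) : ℝ → G) ⁻¹' (oneChart E G).source) :=
  (isOpen_extChartAt_source (1 : G)).preimage (continuous_lieExp_smul X)

lemma lieExp_zero_smul_mem_source (X : GroupLieAlgebra 𝓘(ℝ, E) G) :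
    (lieExp 𝓘(ℝ, E) ((0 : ℝ) • X) : G) ∈ (oneChart E G).source := by
  rw [lieExp_zero_smul]
  exact mem_extChartAt_source 1

lemma hasDerivAt_chart_lieExp_smul (X : GroupLieAlgebra 𝓘(ℝ, E) G) {t : ℝ}
    (ht : lieExp 𝓘(ℝ, E) (t • X) ∈ (oneChart E G).source) :
    HasDerivAt (fun s : ℝ => oneChart E G (lieExp 𝓘(ℝ, E) (s • X)))
      (chartLeft G (oneChart E G (lieExp 𝓘(ℝ, E) (t • X))) X) t := by
  have hchart := ((contMDiffAt_extChartAt_of_mem (E := E) (n := ∞) 1 ht).mdifferentiableAt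
    (by simp)).hasMFDerivAt
  refine (hasDerivAt_of_hasMFDerivAt
    (hchart.comp t (isMIntegralCurve_lieExp_smul X t))).congr_deriv ?_
  rw [chartLeft_apply_eq_mfderiv ht X]
  exact congrArg _ (one_smul ℝ _)

/-- The coordinates of `exp (s X)` solve an autonomous equation with smooth right-hand side. -/
lemma contMDiffAt_lieExp_smul_zero (X : GroupLieAlgebra 𝓘(ℝ, E) G) :
    ContMDiffAt 𝓘(ℝ, ℝ) 𝓘(ℝ, E) ∞ (fun s : ℝ => lieExp 𝓘(ℝ, E) (s • X) : ℝ → G) 0 := by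
  have hnhds := (isOpen_preimage_lieExp_smul X).mem_nhds (lieExp_zero_smul_mem_source X)
  have hfield : ContDiffOn ℝ ∞ (fun a : E => chartLeft G a X) (oneChart E G).target := fun a ha =>
    ((contDiffAt_chartLeft ha).clm_apply contDiffAt_const).contDiffWithinAt
  have hcoord := contDiffOn_of_hasDerivAt_autonomous (n := ⊤) (isOpen_preimage_lieExp_smul X)
    hfield (fun t ht => hasDerivAt_chart_lieExp_smul X ht)
    (fun t ht => (oneChart E G).map_source ht)
  have hsymm := contMDiffAt_extChartAt_symm (n := ∞) (1 : G)
    ((oneChart E G).map_source (lieExp_zero_smul_mem_source X))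
  refine (ContMDiffAt.comp (0 : ℝ) hsymm
    (hcoord.contDiffAt hnhds).contMDiffAt).congr_of_eventuallyEq ?_
  filter_upwards [hnhds] with t ht
  exact ((oneChart E G).left_inv ht).symm

lemma contMDiff_lieExp_smul (X : GroupLieAlgebra 𝓘(ℝ, E) G) :
    ContMDiff 𝓘(ℝ, ℝ) 𝓘(ℝ, E) ∞ (fun s : ℝ => lieExp 𝓘(ℝ, E) (s • X) : ℝ → G) := by
  intro t
  have htranslate : (fun s : ℝ => lieExp 𝓘(ℝ, E) (s • X) : ℝ → G) =
      fun s => lieExp 𝓘(ℝ, E) (t • X) * lieExp 𝓘(ℝ, E) ((s - t) • X) := by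
    funext s
    rw [← lieExp_add_smul, add_sub_cancel]
  have hsub : ContMDiffAt 𝓘(ℝ, ℝ) 𝓘(ℝ, ℝ) ∞ (fun s : ℝ => s - t) t :=
    (contDiffAt_id.sub contDiffAt_const).contMDiffAt
  rw [htranslate]
  exact contMDiffAt_const.mul
    (ContMDiffAt.comp_of_eq (contMDiffAt_lieExp_smul_zero X) hsub (sub_self t))

lemma hasDerivAt_modelAd_lieExp_smul (X : GroupLieAlgebra 𝓘(ℝ, E) G) :
    HasDerivAt (fun s : ℝ => modelAd E (lieExp 𝓘(ℝ, E) (s • X) : G)) (adDeriv E G X) 0 := by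
  have hone : oneChart E G (lieExp 𝓘(ℝ, E) ((0 : ℝ) • X)) = oneChart E G 1 := by
    rw [lieExp_zero_smul]
  have hmodelAd := hasFDerivAt_modelAd_comp_chart_symm (E := E) (G := G)
  rw [← hone] at hmodelAd
  have hcomp := hmodelAd.comp_hasDerivAt (0 : ℝ)
    (hasDerivAt_chart_lieExp_smul X (lieExp_zero_smul_mem_source X))
  rw [hone, chartLeft_one] at hcomp
  refine hcomp.congr_of_eventuallyEq ?_
  filter_upwards [(isOpen_preimage_lieExp_smul X).mem_nhds (lieExp_zero_smul_mem_source X)]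
    with t ht
  simp only [Function.comp_apply, (oneChart E G).left_inv ht]

end Exponential

section ListProd

variable {M : Type*} [Monoid M] {n : ℕ} {f : Fin n → M}

lemma prod_ofFn_eq_one (h : ∀ i, f i = 1) : (List.ofFn f).prod = 1 :=
  List.prod_eq_one ((List.forall_mem_ofFn_iff).2 h)

lemma prod_ofFn_eq_single (j : Fin n) (h : ∀ i, i ≠ j → f i = 1) : (List.ofFn f).prod = f j := by
  induction n with
  | zero => exact j.elim0
  | succ n ih =>
    rw [List.ofFn_succ, List.prod_cons]
    cases j using Fin.cases with
    | zero => rw [prod_ofFn_eq_one fun i => h _ (Fin.succ_ne_zero i), mul_one]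
    | succ j =>
      rw [h 0 (Fin.succ_ne_zero j).symm, one_mul]
      exact ih j fun i hi => h _ ((Fin.succ_injective _).ne hi)

lemma prod_ofFn_eq_pair {j k : Fin n} (hjk : j < k) (h : ∀ i, i ≠ j → i ≠ k → f i = 1) :
    (List.ofFn f).prod = f j * f k := by
  induction n with
  | zero => exact j.elim0
  | succ n ih =>
    rw [List.ofFn_succ, List.prod_cons]
    cases k using Fin.cases with
    | zero => exact absurd hjk (Fin.not_lt_zero j)
    | succ k =>
      cases j using Fin.cases with
      | zero =>
        rw [prod_ofFn_eq_single k fun i hi =>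
          h _ (Fin.succ_ne_zero i) ((Fin.succ_injective _).ne hi)]
      | succ j =>
        rw [h 0 (Fin.succ_ne_zero j).symm (Fin.succ_ne_zero k).symm, one_mul]
        exact ih (Fin.succ_lt_succ_iff.1 hjk) fun i hj hk =>
          h _ ((Fin.succ_injective _).ne hj) ((Fin.succ_injective _).ne hk)

end ListProd

section SecondKind

variable {E : Type*} [NormedAddCommGroup E] [NormedSpace ℝ E]
  {F : Type*} [NormedAddCommGroup F] [NormedSpace ℝ F]
  {G : Type*} [TopologicalSpace G] [ChartedSpace E G]

lemma mfderiv_apply_of_hasMFDerivAt_smul {f : F → G} {v : F} {T : ℝ →L[ℝ] E}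
    (hf : MDifferentiableAt 𝓘(ℝ, F) 𝓘(ℝ, E) f 0)
    (h : HasMFDerivAt 𝓘(ℝ, ℝ) 𝓘(ℝ, E) (fun a : ℝ => f (a • v)) 0 T) :
    mfderiv 𝓘(ℝ, F) 𝓘(ℝ, E) f 0 v = T 1 := by
  have hline : HasMFDerivAt 𝓘(ℝ, ℝ) 𝓘(ℝ, F) (fun a : ℝ => a • v) 0
      ((1 : ℝ →L[ℝ] ℝ).smulRight v) :=
    ((1 : ℝ →L[ℝ] ℝ).smulRight v).hasFDerivAt.hasMFDerivAt
  have hcomp := mfderiv_comp_apply_of_eq (x := (0 : ℝ)) hf hline.mdifferentiableAt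
    (zero_smul ℝ v) 1
  have hT : mfderiv 𝓘(ℝ, ℝ) 𝓘(ℝ, E) (f ∘ fun a : ℝ => a • v) 0 = T := h.mfderiv
  rw [hT, hline.mfderiv] at hcomp
  refine Eq.trans ?_ hcomp.symm
  exact congrArg (mfderiv 𝓘(ℝ, F) 𝓘(ℝ, E) f 0) (one_smul ℝ v).symm

variable [Group G] [LieGroup 𝓘(ℝ, E) ∞ G]

lemma contMDiff_prod_ofFn {n : ℕ} {f : Fin n → F → G}
    (hf : ∀ i, ContMDiff 𝓘(ℝ, F) 𝓘(ℝ, E) ∞ (f i)) :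
    ContMDiff 𝓘(ℝ, F) 𝓘(ℝ, E) ∞ (fun p => (List.ofFn fun i => f i p).prod) := by
  induction n with
  | zero => simpa using contMDiff_const
  | succ n ih =>
    simp only [List.ofFn_succ, List.prod_cons]
    exact (hf 0).mul (ih fun i => hf i.succ)

variable [CompleteSpace E] [T2Space G] {n : ℕ} (Y : Fin n → GroupLieAlgebra 𝓘(ℝ, E) G) (x : G)

lemma contMDiff_secondKind :
    ContMDiff 𝓘(ℝ, Fin n → ℝ) 𝓘(ℝ, E) ∞ (secondKind 𝓘(ℝ, E) Y x) :=
  contMDiff_const.mul (contMDiff_prod_ofFn fun i =>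
    (contMDiff_lieExp_smul (Y i)).comp (contDiff_apply ℝ ℝ i).contMDiff)

lemma secondKind_zero : secondKind 𝓘(ℝ, E) Y x 0 = x := by
  rw [secondKind, prod_ofFn_eq_one fun i => by rw [Pi.zero_apply, lieExp_zero_smul], mul_one]

lemma secondKind_smul_single (j : Fin n) (a : ℝ) :
    secondKind 𝓘(ℝ, E) Y x (a • Pi.single j 1) = x * lieExp 𝓘(ℝ, E) (a • Y j) := by
  rw [secondKind, prod_ofFn_eq_single j]
  · simp
  · intro i hi
    simp only [Pi.smul_apply, Pi.single_eq_of_ne hi, smul_zero, lieExp_zero_smul]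

lemma secondKind_smul_single_add_smul_single {j k : Fin n} (hjk : j < k) (a b : ℝ) :
    secondKind 𝓘(ℝ, E) Y x (a • Pi.single j 1 + b • Pi.single k 1) =
      x * (lieExp 𝓘(ℝ, E) (a • Y j) * lieExp 𝓘(ℝ, E) (b • Y k)) := by
  rw [secondKind, prod_ofFn_eq_pair hjk]
  · simp [Pi.single_eq_of_ne hjk.ne, Pi.single_eq_of_ne hjk.ne']
  · intro i hj hk
    simp only [Pi.add_apply, Pi.smul_apply, Pi.single_eq_of_ne hj, Pi.single_eq_of_ne hk,
      smul_zero, add_zero, lieExp_zero_smul]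

lemma mfderiv_secondKind (j : Fin n) :
    mfderiv 𝓘(ℝ, Fin n → ℝ) 𝓘(ℝ, E) (secondKind 𝓘(ℝ, E) Y x) 0
      (Pi.single j (1 : ℝ) : Fin n → ℝ) =
    mulInvariantVectorField (Y j) (secondKind 𝓘(ℝ, E) Y x 0) := by
  have hcurve := isMIntegralCurve_mul_left (isMIntegralCurve_lieExp_smul (Y j)) x
  simp only [← secondKind_smul_single] at hcurve
  refine (mfderiv_apply_of_hasMFDerivAt_smul
    ((contMDiff_secondKind Y x).mdifferentiableAt (by simp)) (hcurve 0)).trans ?_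
  rw [← zero_smul ℝ (Pi.single j (1 : ℝ) : Fin n → ℝ)]
  exact one_smul ℝ (mulInvariantVectorField (Y j) _ : E)

lemma isLocalDiffeomorphAt_secondKind
    (Y : Module.Basis (Fin n) ℝ (GroupLieAlgebra 𝓘(ℝ, E) G)) :
    IsLocalDiffeomorphAt 𝓘(ℝ, Fin n → ℝ) 𝓘(ℝ, E) ∞ (secondKind 𝓘(ℝ, E) Y x) 0 := by
  let Y' : (Fin n → ℝ) ≃ₗ[ℝ] E := Y.equivFun.symm
  have : FiniteDimensional ℝ E := Y'.finiteDimensional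
  let D := Y'.toContinuousLinearEquiv.trans
    (leftTranslationEquiv E (secondKind 𝓘(ℝ, E) Y x 0))
  have hD : HasMFDerivAt 𝓘(ℝ, Fin n → ℝ) 𝓘(ℝ, E) (secondKind 𝓘(ℝ, E) Y x) 0
      (D : (Fin n → ℝ) →L[ℝ] E) := by
    have hd := ((contMDiff_secondKind Y x).mdifferentiableAt (by simp) (x := 0)).hasMFDerivAt
    refine hd.congr_mfderiv (ContinuousLinearMap.coe_inj.1
      ((Pi.basisFun ℝ (Fin n)).ext fun j => ?_))
    rw [Pi.basisFun_apply]
    have hY : Y.equivFun.symm (Pi.single j 1) = Y j := by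
      rw [Y.equivFun_symm_apply, Finset.sum_eq_single j] <;> simp +contextual
    exact (mfderiv_secondKind Y x j).trans
      (congrArg (leftTranslationEquiv E (secondKind 𝓘(ℝ, E) Y x 0)) hY).symm
  exact isLocalDiffeomorphAt_of_hasMFDerivAt (by simp)
    (Filter.Eventually.of_forall fun s => contMDiff_secondKind Y x s) hD

end SecondKind

section TraceSecondKind

variable {E : Type*} [NormedAddCommGroup E] [NormedSpace ℝ E] [FiniteDimensional ℝ E]
  [CompleteSpace E] {G : Type*} [TopologicalSpace G] [ChartedSpace E G] [Group G]
  [LieGroup 𝓘(ℝ, E) ∞ G] [T2Space G] {n : ℕ} (Y : Fin n → GroupLieAlgebra 𝓘(ℝ, E) G) (x : G)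

lemma contDiff_V_secondKind : ContDiff ℝ ∞ (V 𝓘(ℝ, E) ∘ secondKind 𝓘(ℝ, E) Y x) :=
  (contMDiff_V.comp (contMDiff_secondKind Y x)).contDiff

variable {x} (hx : Ad 𝓘(ℝ, E) x = ContinuousLinearMap.id ℝ (GroupLieAlgebra 𝓘(ℝ, E) G))
include hx

lemma V_secondKind_smul_single (j : Fin n) (a : ℝ) :
    V 𝓘(ℝ, E) (secondKind 𝓘(ℝ, E) Y x (a • Pi.single j 1)) =
      traceCLM E (modelAd E (lieExp 𝓘(ℝ, E) (a • Y j) : G)) := by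
  rw [secondKind_smul_single, V_mul_of_Ad_eq_id hx, V_eq_traceCLM]

lemma V_secondKind_smul_single_add_smul_single (j k : Fin n) (a b : ℝ) :
    V 𝓘(ℝ, E) (secondKind 𝓘(ℝ, E) Y x (a • Pi.single j 1 + b • Pi.single k 1)) =
      traceCLM E ((modelAd E (lieExp 𝓘(ℝ, E) (a • Y j) : G)).comp
        (modelAd E (lieExp 𝓘(ℝ, E) (b • Y k) : G))) := by
  rcases lt_trichotomy j k with hjk | rfl | hjk
  · rw [secondKind_smul_single_add_smul_single Y x hjk, V_mul_of_Ad_eq_id hx, V_eq_traceCLM,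
      modelAd_mul]
  · rw [← add_smul, V_secondKind_smul_single Y hx, lieExp_add_smul, modelAd_mul]
  · rw [add_comm, secondKind_smul_single_add_smul_single Y x hjk, V_mul_of_Ad_eq_id hx,
      V_eq_traceCLM, modelAd_mul, traceCLM_comp_comm]

lemma fderiv_V_secondKind [LieAlgebra.IsKilling ℝ (GroupLieAlgebra 𝓘(ℝ, E) G)] :
    fderiv ℝ (V 𝓘(ℝ, E) ∘ secondKind 𝓘(ℝ, E) Y x) 0 = 0 := by
  refine ContinuousLinearMap.coe_inj.1 ((Pi.basisFun ℝ (Fin n)).ext fun j => ?_)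
  have hderiv := hasDerivAt_comp_add_smul
    ((contDiff_V_secondKind Y x).differentiable (by simp) 0) (Pi.single j 1)
  simp only [zero_add, Function.comp_apply, V_secondKind_smul_single Y hx] at hderiv
  rw [Pi.basisFun_apply]
  exact (hderiv.unique ((traceCLM E).hasFDerivAt.comp_hasDerivAt (0 : ℝ)
    (hasDerivAt_modelAd_lieExp_smul (Y j)))).trans (traceCLM_adDeriv (Y j))

lemma hessian_V_secondKind (j k : Fin n) :
    hessian (V 𝓘(ℝ, E) ∘ secondKind 𝓘(ℝ, E) Y x) 0 (Pi.single j 1) (Pi.single k 1) =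
      killingForm ℝ (GroupLieAlgebra 𝓘(ℝ, E) G) (Y j) (Y k) := by
  let traceComp : (E →L[ℝ] E) →L[ℝ] (E →L[ℝ] E) →L[ℝ] ℝ :=
    (ContinuousLinearMap.compL ℝ (E →L[ℝ] E) (E →L[ℝ] E) ℝ (traceCLM E)).comp
      (ContinuousLinearMap.compL ℝ E E E)
  rw [killingForm_eq_traceCLM]
  refine hessian_apply_of_eq_bilin ((contDiff_V_secondKind Y x).of_le ENat.LEInfty.out) traceComp
    (hasDerivAt_modelAd_lieExp_smul (Y j)) (hasDerivAt_modelAd_lieExp_smul (Y k)) fun a b => ?_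
  rw [zero_add]
  exact V_secondKind_smul_single_add_smul_single Y hx j k a b

end TraceSecondKind

section CriticalSet

variable {E : Type*} [NormedAddCommGroup E] [NormedSpace ℝ E]
  {G : Type*} [TopologicalSpace G] [ChartedSpace E G] [Group G]
  {m : ℕ} {X : Fin m → GroupLieAlgebra 𝓘(ℝ, E) G} {xr : ℝ → G} {w : G}

lemma mem_criticalSet_of_mfderiv_eq_zero
    (hw : mfderiv 𝓘(ℝ, E) 𝓘(ℝ, ℝ) (V 𝓘(ℝ, E) : G → ℝ) w = 0) :
    w ∈ criticalSet 𝓘(ℝ, E) X xr := fun t =>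
  Finset.sum_eq_zero fun k _ => by
    rw [feedback, hw]
    exact zero_smul ℝ _

lemma feedback_eq_zero_of_mem_criticalSet (hw : w ∈ criticalSet 𝓘(ℝ, E) X xr)
    (t : ℝ) (k : Fin m) : feedback 𝓘(ℝ, E) X xr k t w = 0 := by
  -- Pairing `W(t, w) = 0` with `dV` gives `∑ a_k(t, w)² = 0`.
  have hsum := congrArg (mfderiv 𝓘(ℝ, E) 𝓘(ℝ, ℝ) (V 𝓘(ℝ, E) : G → ℝ) w) (hw t)
  rw [auxField, map_sum, map_zero] at hsum
  have hsq : ∑ k, feedback 𝓘(ℝ, E) X xr k t w * feedback 𝓘(ℝ, E) X xr k t w = 0 :=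
    (Finset.sum_congr rfl fun k _ => (map_smul _ _ _).symm).trans hsum
  rw [Finset.sum_eq_zero_iff_of_nonneg fun k _ => mul_self_nonneg _] at hsq
  exact mul_self_eq_zero.1 (hsq k (Finset.mem_univ k))

variable [LieGroup 𝓘(ℝ, E) ∞ G]

lemma mem_criticalSet_iff_mfderiv_eq_zero (hreg : IsRegular 𝓘(ℝ, E) X xr) :
    w ∈ criticalSet 𝓘(ℝ, E) X xr ↔
      mfderiv 𝓘(ℝ, E) 𝓘(ℝ, ℝ) (V 𝓘(ℝ, E) : G → ℝ) w = 0 := by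
  refine ⟨fun hw => ?_, mem_criticalSet_of_mfderiv_eq_zero⟩
  let D : E →L[ℝ] ℝ := mfderiv 𝓘(ℝ, E) 𝓘(ℝ, ℝ) (V 𝓘(ℝ, E) : G → ℝ) w
  let L : E ≃L[ℝ] E := leftTranslationEquiv E w
  have hspan : Submodule.span ℝ
      (Set.range fun p : ℝ × Fin m => modelAd E (xr p.1) (X p.2)) = ⊤ := hreg
  have hcomp : D ∘ₗ L.toLinearMap = (0 : E →ₗ[ℝ] ℝ) :=
    LinearMap.ext_on_range hspan fun p => feedback_eq_zero_of_mem_criticalSet hw p.1 p.2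
  ext v
  obtain ⟨u, rfl⟩ := L.surjective v
  exact LinearMap.congr_fun hcomp u

variable [FiniteDimensional ℝ E] {x : G}

lemma isIsolatedPoint_criticalSet
    (hx : IsNondegenerateCriticalPoint 𝓘(ℝ, E) (V 𝓘(ℝ, E) : G → ℝ) x)
    (hreg : IsRegular 𝓘(ℝ, E) X xr) :
    IsIsolatedPoint (criticalSet 𝓘(ℝ, E) X xr) x := by
  have hmem := mem_criticalSet_of_mfderiv_eq_zero (X := X) (xr := xr) hx.critical
  obtain ⟨U, hU, hUo, hxU⟩ := mem_nhds_iff.1 hx.eventually_eq_of_mfderiv_eq_zero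
  refine ⟨hmem, U, hUo, Set.Subset.antisymm ?_ (Set.singleton_subset_iff.2 ⟨hxU, hmem⟩)⟩
  exact fun w hw => hU hw.1 ((mem_criticalSet_iff_mfderiv_eq_zero hreg).1 hw.2)

variable [CompleteSpace E] [T2Space G]
  [LieAlgebra.IsKilling ℝ (GroupLieAlgebra 𝓘(ℝ, E) G)]

lemma isNondegenerateCriticalPoint_V
    (hx : Ad 𝓘(ℝ, E) x = ContinuousLinearMap.id ℝ (GroupLieAlgebra 𝓘(ℝ, E) G)) :
    IsNondegenerateCriticalPoint 𝓘(ℝ, E) (V 𝓘(ℝ, E) : G → ℝ) x := by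
  let Y : Module.Basis (Fin (Module.finrank ℝ E)) ℝ (GroupLieAlgebra 𝓘(ℝ, E) G) :=
    Module.finBasis ℝ E
  rw [← secondKind_zero Y x]
  refine isNondegenerateCriticalPoint_of_comp (Filter.Eventually.of_forall fun y => contMDiff_V y)
    (isLocalDiffeomorphAt_secondKind x Y) (fderiv_V_secondKind Y hx) fun v hv => ?_
  have hkilling : killingForm ℝ (GroupLieAlgebra 𝓘(ℝ, E) G) (Y.equivFun.symm v) = 0 :=
    Y.ext fun j => by
      rw [Y.equivFun_symm_apply, LinearMap.zero_apply, ← hv (Pi.single j 1)]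
      conv_rhs => rw [pi_eq_sum_univ' v]
      simp only [map_sum, map_smul, LinearMap.sum_apply, LinearMap.smul_apply, sum_apply,
        smul_apply, hessian_V_secondKind Y hx]
  refine (LinearEquiv.map_eq_zero_iff Y.equivFun.symm).1 ?_
  exact (LieAlgebra.IsKilling.killingForm_nondegenerate ℝ _).1 _ fun z =>
    LinearMap.congr_fun hkilling z

end CriticalSet

end LieTracking

end

theorem mainTheorem4_general
    {E : Type*} [NormedAddCommGroup E] [NormedSpace ℝ E] [FiniteDimensional ℝ E] [CompleteSpace E]
    {G : Type*} [TopologicalSpace G] [ChartedSpace E G] [Group G] [LieGroup 𝓘(ℝ, E) ∞ G]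
    [T2Space G]
    (hG : LieAlgebra.HasTrivialRadical ℝ (GroupLieAlgebra 𝓘(ℝ, E) G))
    (x : G) (hx : LieTracking.Ad 𝓘(ℝ, E) x =
      ContinuousLinearMap.id ℝ (GroupLieAlgebra 𝓘(ℝ, E) G)) :
    LieTracking.IsNondegenerateCriticalPoint 𝓘(ℝ, E) (LieTracking.V 𝓘(ℝ, E) : G → ℝ) x ∧
    (∀ (n : ℕ) (Y : Module.Basis (Fin n) ℝ (GroupLieAlgebra 𝓘(ℝ, E) G)),
      LieTracking.secondKind 𝓘(ℝ, E) Y x 0 = x ∧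
      IsLocalDiffeomorphAt 𝓘(ℝ, Fin n → ℝ) 𝓘(ℝ, E) ∞
        (LieTracking.secondKind 𝓘(ℝ, E) Y x) 0 ∧
      (∀ j, mfderiv 𝓘(ℝ, Fin n → ℝ) 𝓘(ℝ, E) (LieTracking.secondKind 𝓘(ℝ, E) Y x) 0
          (Pi.single j (1 : ℝ) : Fin n → ℝ) =
        mulInvariantVectorField (Y j) (LieTracking.secondKind 𝓘(ℝ, E) Y x 0)) ∧
      ∀ j k, LieTracking.hessian
          (LieTracking.V 𝓘(ℝ, E) ∘ LieTracking.secondKind 𝓘(ℝ, E) Y x) 0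
          (Pi.single j 1) (Pi.single k 1) =
        killingForm ℝ (GroupLieAlgebra 𝓘(ℝ, E) G) (Y j) (Y k)) ∧
    (∀ (m : ℕ) (X : Fin m → GroupLieAlgebra 𝓘(ℝ, E) G) (xr : ℝ → G),
      LieTracking.IsRegular 𝓘(ℝ, E) X xr →
      LieTracking.IsIsolatedPoint (LieTracking.criticalSet 𝓘(ℝ, E) X xr) x) := by
  have hkilling : LieAlgebra.IsKilling ℝ (GroupLieAlgebra 𝓘(ℝ, E) G) := inferInstance
  have hcrit := LieTracking.isNondegenerateCriticalPoint_V hx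
  exact ⟨hcrit,
    fun _ Y => ⟨LieTracking.secondKind_zero Y x, LieTracking.isLocalDiffeomorphAt_secondKind x Y,
      LieTracking.mfderiv_secondKind Y x, LieTracking.hessian_V_secondKind Y hx⟩,
    fun _ _ _ hreg => LieTracking.isIsolatedPoint_criticalSet hcrit hreg⟩

theorem mainTheorem4
    {E : Type*} [NormedAddCommGroup E] [NormedSpace ℝ E] [FiniteDimensional ℝ E] [CompleteSpace E]
    {G : Type*} [TopologicalSpace G] [ChartedSpace E G] [Group G] [LieGroup 𝓘(ℝ, E) ∞ G]
    [T2Space G] [CompactSpace G] [ConnectedSpace G]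
    (hG : LieAlgebra.HasTrivialRadical ℝ (GroupLieAlgebra 𝓘(ℝ, E) G))
    (x : G) (hx : x ∈ Subgroup.center G) :
    LieTracking.IsNondegenerateCriticalPoint 𝓘(ℝ, E) (LieTracking.V 𝓘(ℝ, E) : G → ℝ) x ∧
    (∀ (n : ℕ) (Y : Module.Basis (Fin n) ℝ (GroupLieAlgebra 𝓘(ℝ, E) G)),
      LieTracking.secondKind 𝓘(ℝ, E) Y x 0 = x ∧
      IsLocalDiffeomorphAt 𝓘(ℝ, Fin n → ℝ) 𝓘(ℝ, E) ∞
        (LieTracking.secondKind 𝓘(ℝ, E) Y x) 0 ∧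
      (∀ j, mfderiv 𝓘(ℝ, Fin n → ℝ) 𝓘(ℝ, E) (LieTracking.secondKind 𝓘(ℝ, E) Y x) 0
          (Pi.single j (1 : ℝ) : Fin n → ℝ) =
        mulInvariantVectorField (Y j) (LieTracking.secondKind 𝓘(ℝ, E) Y x 0)) ∧
      ∀ j k, LieTracking.hessian
          (LieTracking.V 𝓘(ℝ, E) ∘ LieTracking.secondKind 𝓘(ℝ, E) Y x) 0
          (Pi.single j 1) (Pi.single k 1) =
        killingForm ℝ (GroupLieAlgebra 𝓘(ℝ, E) G) (Y j) (Y k)) ∧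
    (∀ (m : ℕ) (X : Fin m → GroupLieAlgebra 𝓘(ℝ, E) G)
      (xr : ℝ → G) (ur : Fin m → ℝ → ℝ) (T : ℝ),
      LieTracking.IsPeriodicTrajectory 𝓘(ℝ, E) X xr ur T →
      LieTracking.IsRegular 𝓘(ℝ, E) X xr →
      LieTracking.IsIsolatedPoint (LieTracking.criticalSet 𝓘(ℝ, E) X xr) x) := by
  have general := mainTheorem4_general hG x (LieTracking.Ad_eq_id_of_mem_center hx)
  exact ⟨general.1, general.2.1, fun m X xr _ _ _ => general.2.2 m X xr⟩
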